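/- Let $X$ be a real reflexive Banach space with continuous dual $X^*$ and pairing $\langle x,x^*\rangle=x^*(x)$. Let $A\colon X\rightrightarrows X^*$ be a set-valued operator with graph $\operatorname{gra}A=\{(x,x^*): x^*\in Ax\}$ and domain $\operatorname{dom}A=\{x: Ax\ne\varnothing\}$. Assume that - $A$ is a linear relation, i.e. $\operatorname{gra}A$ is a linear subspace of $X\times X^*$; - $A$ is maximal monotone, i.e. $\langle x-y,x^*-y^*\rangle\ge 0$ for all $(x,x^*),(y,y^*)\in\operatorname{gra}A$, and no operator with strictly larger graph has this property; - $A$ is symmetric, i.e. $\langle y,x^*\rangle=\langle x,y^*\rangle$ for all $(x,x^*),(y,y^*)\in\operatorname{gra}A$. Define $q_A\colon X\to\,]-\infty,+\infty]$ by $q_A(x)=\tfrac12\langle x,x^*\rangle$ for any $x^*\in Ax$ if $x\in\operatorname{dom}A$ (the value does not depend on the choice of $x^*$), and $q_A(x)=+\infty$ otherwise. Let $\overline{q_A}$ be the lower semicontinuous hull of $q_A$ (its largest lower semicontinuous minorant), and let $q_A^*(x^*)=\sup_{x\in X}\big(\langle x,x^*\rangle-q_A(x)\big)$ be its Fenchel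 conjugate. Let $$F_A(x,x^*)=\sup_{(a,a^*)\in\operatorname{gra}A}\big(\langle x,a^*\rangle+\langle a,x^*\rangle-\langle a,a^*\rangle\big)$$ be the Fitzpatrick function of $A$; for $n\in\{2,3,\dots\}$ let $$F_{A,n}(x,x^*)=\sup\Big(\langle x,x^*\rangle+\sum_{i=1}^{n-2}\langle a_{i+1}-a_i,a_i^*\rangle+\langle x-a_{n-1},a_{n-1}^*\rangle+\langle a_1-x,x^*\rangle\Big),$$ where the supremum is over all $(a_1,a_1^*),\dots,(a_{n-1},a_{n-1}^*)\in\operatorname{gra}A$ (not necessarily distinct), be the Fitzpatrick function of order $n$; and let $F_{A,\infty}=\sup_{n\ge2}F_{A,n}$. All these functions take values in $[-\infty,+\infty]$. Then for every $n\in\{2,3,\dots\}$ and every $(x,x^*)\in X\times X^*$, $$F_{A,n}(x,x^*)=\tfrac{n-1}{n}\,\overline{q_A}(x)+\tfrac{n-1}{n}\,q_A^*(x^*)+\tfrac1n\langle x,x^*\rangle$$ and $$F_{A,n}(x,x^*)=\tfrac{2(n-1)}{n}F_A(x,x^*)+\tfrac{2-n}{n}\langle x,x^*\rangle .$$ Moreover,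 $$F_{A,\infty}=\overline{q_A}\oplus q_A^*=2F_A-\langle\cdot,\cdot\rangle\quad\text{on }X\times X^*,$$ where $(\overline{q_A}\oplus q_A^*)(x,x^*)=\overline{q_A}(x)+q_A^*(x^*)$. -/

import Mathlib

noncomputable section

namespace FitzpatrickLinRel

variable {X : Type*} [NormedAddCommGroup X] [NormedSpace ℝ X]

/-- The graph of a set-valued operator from `X` to its continuous dual. -/
def gra (A : X → Set (StrongDual ℝ X)) : Set (X × StrongDual ℝ X) :=
  {p | p.2 ∈ A p.1}

/-- The graph is a linear subspace. -/
def IsLinearRelation (A : X → Set (StrongDual ℝ X)) : Prop :=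
  ∃ S : Submodule ℝ (X × StrongDual ℝ X), (S : Set (X × StrongDual ℝ X)) = gra A

def IsMonotone (A : X → Set (StrongDual ℝ X)) : Prop :=
  ∀ p ∈ gra A, ∀ r ∈ gra A, 0 ≤ (p.2 - r.2) (p.1 - r.1)

/-- Monotone, without a proper monotone extension. -/
def IsMaximalMonotone (A : X → Set (StrongDual ℝ X)) : Prop :=
  IsMonotone A ∧
    ∀ B : X → Set (StrongDual ℝ X), IsMonotone B → gra A ⊆ gra B → gra B = gra A

/-- `⟨Ax, y⟩ = ⟨Ay, x⟩` for all `x, y` in the domain of `A`, whichever values of `A` at `x`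
and `y` are taken. -/
def IsSymmetric (A : X → Set (StrongDual ℝ X)) : Prop :=
  ∀ p ∈ gra A, ∀ r ∈ gra A, p.2 r.1 = r.2 p.1

/-- `q_A(x) = ½⟨x, Ax⟩` on the domain of `A` and `+∞` off it. For a monotone linear relation the
family under the infimum is constant, see `quad_eq`; off the domain it is empty. -/
def quad (A : X → Set (StrongDual ℝ X)) (x : X) : EReal :=
  ⨅ xs ∈ A x, (((1 / 2 : ℝ) * xs x : ℝ) : EReal)

/-- The value of `q_A` at a point of the domain does not depend on the chosen element of `A x`. -/
theorem quad_eq {A : X → Set (StrongDual ℝ X)} (hlin : IsLinearRelation A) (hmon : IsMonotone A)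
    {x : X} {xs : StrongDual ℝ X} (h : xs ∈ A x) :
    quad A x = (((1 / 2 : ℝ) * xs x : ℝ) : EReal) := by
  obtain ⟨S, hS⟩ := hlin
  have key : ∀ ys ∈ A x, ys x = xs x := by
    intro ys hy
    have hx' : ((x, xs) : X × StrongDual ℝ X) ∈ S := by
      rw [← SetLike.mem_coe, hS]; exact h
    have hy' : ((x, ys) : X × StrongDual ℝ X) ∈ S := by
      rw [← SetLike.mem_coe, hS]; exact hy
    have hall : ∀ t : ℝ, 0 ≤ xs x + t * (ys x - xs x) := by
      intro t
      have h1 : ((x, xs) : X × StrongDual ℝ X) + t • ((x, ys) - (x, xs)) ∈ gra A := by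
        rw [← hS]; exact S.add_mem hx' (S.smul_mem t (S.sub_mem hy' hx'))
      have h0 : (0 : X × StrongDual ℝ X) ∈ gra A := by
        rw [← hS]; exact S.zero_mem
      have := hmon _ h1 _ h0
      simpa using this
    by_contra hne
    have hd : ys x - xs x ≠ 0 := sub_ne_zero.mpr hne
    have := hall (-(xs x + 1) / (ys x - xs x))
    rw [div_mul_cancel₀ _ hd] at this
    linarith
  apply le_antisymm
  · exact iInf₂_le xs h
  · refine le_iInf₂ fun ys hy => ?_
    rw [key ys hy]

theorem quad_eq_top {A : X → Set (StrongDual ℝ X)} {x : X} (h : ¬ (A x).Nonempty) :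
    quad A x = ⊤ := by
  rw [Set.not_nonempty_iff_eq_empty] at h
  simp [quad, h]

/-- The lower semicontinuous hull: the largest lower semicontinuous minorant (norm topology). -/
def lscHull (f : X → EReal) (x : X) : EReal :=
  ⨆ (g : X → EReal) (_ : LowerSemicontinuous g ∧ ∀ y, g y ≤ f y), g x

/-- The Fenchel conjugate. -/
def conjugate (f : X → EReal) (xs : StrongDual ℝ X) : EReal :=
  ⨆ x : X, ((xs x : ℝ) : EReal) - f x

/-- `(f ⊕ g)(x, x*) = f(x) + g(x*)`. -/
def directSum (f : X → EReal) (g : StrongDual ℝ X → EReal) (p : X × StrongDual ℝ X) : EReal :=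
  f p.1 + g p.2

/-- The Fitzpatrick function of `A`. -/
def fitzpatrick (A : X → Set (StrongDual ℝ X)) (p : X × StrongDual ℝ X) : EReal :=
  ⨆ a ∈ gra A, ((a.2 p.1 + p.2 a.1 - a.2 a.1 : ℝ) : EReal)

/-- The Fitzpatrick function of order `n`, for `n ≥ 2`. The supremum runs over the families
`(a₁, a₁*), …, (aₙ₋₁, aₙ₋₁*)` in the graph; a family is written as a sequence of which only the
entries with index `1, …, n - 1` are constrained and only these are used. -/
def fitzpatrickOrder (A : X → Set (StrongDual ℝ X)) (n : ℕ) (p : X × StrongDual ℝ X) : EReal :=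
  ⨆ (a : ℕ → X × StrongDual ℝ X) (_ : ∀ i ∈ Finset.Icc 1 (n - 1), a i ∈ gra A),
    ((p.2 p.1 + (∑ i ∈ Finset.Icc 1 (n - 2), (a i).2 ((a (i + 1)).1 - (a i).1))
      + (a (n - 1)).2 (p.1 - (a (n - 1)).1) + p.2 ((a 1).1 - p.1) : ℝ) : EReal)

/-- The Fitzpatrick function of infinite order. -/
def fitzpatrickInfty (A : X → Set (StrongDual ℝ X)) (p : X × StrongDual ℝ X) : EReal :=
  ⨆ (n : ℕ) (_ : 2 ≤ n), fitzpatrickOrder A n p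

end FitzpatrickLinRel

end

/-!
Write `c = ⟨x, x*⟩` and `q = q_A`. Everything rests on two facts about a symmetric maximal monotone
linear relation `A`.

* A maximal monotone operator has `F_A ≥ ⟨·,·⟩`. By symmetry `F_A` is unchanged under
  `(x, x*) ↦ (x - v, x* + v*)` for `(v, v*)` in the graph, so
  `F_A(x, x*) ≥ ⟨x - v, x* + v*⟩`; the supremum over `(v, v*)` reads
  `F_A(x, -x*) ≤ F_A(x, x*) - c`, and exchanging `x*` and `-x*` gives equality
  (`fitzpatrick_neg`).
* Fix the first and last points `s = u - v`, `t = u + v` of a chain of `n - 1` points. Completing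
  squares, the sum over the chain is largest when the points divide the segment from `s` to `t`
  equally, and the maximal value splits into a term in `u` and a term in a multiple of `v`. Hence
  `F_{A,n}(x, x*) = F_A(x, x*) + ((n - 2) / n) F_A(x, -x*)` (`fitzpatrickOrder_eq_add`). The same
  substitution gives `p(x) + q*(x*) = F_A(x, x*) + F_A(x, -x*)` (`affineEnvelope_add_conjugate`),
  where `p` is the supremum of the affine minorants of `q` that are exact at a point of the domain.

Therefore `p ⊕ q* = 2 F_A - ⟨·,·⟩ ≥ ⟨·,·⟩`, so `p` is at least the biconjugate of `q`. By the
Hahn–Banach theorem the biconjugate is at least the lower semicontinuous hull, which in turn is at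
least `p`; thus `p` is the hull (`lscHull_quad`), and the formulas follow by arithmetic in the
extended reals.
-/

noncomputable section

namespace FitzpatrickLinRel

/-! ### Suprema of real families in the extended reals -/

theorem iSup_add_mul_iSup {ι : Type*} [Nonempty ι] (f g : ι → ℝ) {k : ℝ} (hk : 0 ≤ k) :
    (⨆ i, (f i : EReal)) + (k : EReal) * ⨆ j, (g j : EReal)
      = ⨆ ij : ι × ι, ((f ij.1 + k * g ij.2 : ℝ) : EReal) := by
  have hk' : (0 : EReal) ≤ k := EReal.coe_nonneg.mpr hk
  apply le_antisymm
  · rcases hk.eq_or_lt with rfl | hpos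
    · rw [EReal.coe_zero, zero_mul, add_zero]
      refine iSup_le fun i => ?_
      refine le_trans (le_of_eq ?_) (le_iSup _ ((i, i) : ι × ι))
      simp
    · refine EReal.add_le_of_forall_lt fun a ha b hb => ?_
      obtain ⟨i, hi⟩ := lt_iSup_iff.mp ha
      have : ∃ j, b < ((k * g j : ℝ) : EReal) := by
        by_contra! hcon
        refine absurd hb (not_lt.mpr ?_)
        induction b with
        | top => exact le_top
        | bot =>
          obtain ⟨j⟩ := ‹Nonempty ι›
          exact absurd (hcon j) (not_le.mpr (EReal.bot_lt_coe _))
        | coe b =>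
          have h1 : (⨆ j, (g j : EReal)) ≤ ((b / k : ℝ) : EReal) := by
            refine iSup_le fun j => EReal.coe_le_coe_iff.mpr ?_
            rw [le_div_iff₀ hpos, mul_comm]
            exact EReal.coe_le_coe_iff.mp (hcon j)
          refine (mul_le_mul_of_nonneg_left h1 hk').trans (le_of_eq ?_)
          rw [← EReal.coe_mul, mul_div_cancel₀ _ hpos.ne']
      obtain ⟨j, hj⟩ := this
      refine le_trans ?_ (le_iSup _ ((i, j) : ι × ι))
      rw [EReal.coe_add]
      exact add_le_add hi.le hj.le
  · refine iSup_le fun ij => ?_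
    rw [EReal.coe_add, EReal.coe_mul]
    exact add_le_add (le_iSup (fun i => (f i : EReal)) ij.1)
      (mul_le_mul_of_nonneg_left (le_iSup (fun j => (g j : EReal)) ij.2) hk')

variable {X : Type*} [NormedAddCommGroup X] [NormedSpace ℝ X] {A : X → Set (StrongDual ℝ X)}

/-! ### The graph and the Fitzpatrick function -/

theorem IsLinearRelation.zero_mem (h : IsLinearRelation A) : (0 : X × StrongDual ℝ X) ∈ gra A := by
  obtain ⟨S, hS⟩ := h
  rw [← hS]; exact S.zero_mem

theorem IsLinearRelation.add_mem (h : IsLinearRelation A) {a b : X × StrongDual ℝ X}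
    (ha : a ∈ gra A) (hb : b ∈ gra A) : a + b ∈ gra A := by
  obtain ⟨S, hS⟩ := h
  rw [← hS, SetLike.mem_coe] at ha hb ⊢
  exact S.add_mem ha hb

theorem IsLinearRelation.smul_mem (h : IsLinearRelation A) {a : X × StrongDual ℝ X} (t : ℝ)
    (ha : a ∈ gra A) : t • a ∈ gra A := by
  obtain ⟨S, hS⟩ := h
  rw [← hS, SetLike.mem_coe] at ha ⊢
  exact S.smul_mem t ha

theorem IsLinearRelation.sub_mem (h : IsLinearRelation A) {a b : X × StrongDual ℝ X}
    (ha : a ∈ gra A) (hb : b ∈ gra A) : a - b ∈ gra A := by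
  obtain ⟨S, hS⟩ := h
  rw [← hS, SetLike.mem_coe] at ha hb ⊢
  exact S.sub_mem ha hb

theorem IsLinearRelation.nonempty_gra (h : IsLinearRelation A) : Nonempty (gra A) :=
  ⟨⟨0, h.zero_mem⟩⟩

theorem fitzpatrick_eq_iSup (x : X) (xs : StrongDual ℝ X) :
    fitzpatrick A (x, xs)
      = ⨆ a : gra A, ((a.1.2 x + xs a.1.1 - a.1.2 a.1.1 : ℝ) : EReal) := by
  rw [fitzpatrick, iSup_subtype']

theorem fitzpatrick_nonneg (hlin : IsLinearRelation A) (p : X × StrongDual ℝ X) :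
    0 ≤ fitzpatrick A p := by
  refine le_trans (le_of_eq ?_) (le_iSup₂ (0 : X × StrongDual ℝ X) hlin.zero_mem)
  simp

/-- If the Fitzpatrick function were smaller than the pairing at a point, adding that point to the
graph would give a proper monotone extension. -/
theorem pairing_le_fitzpatrick (hmax : IsMaximalMonotone A) (x : X) (xs : StrongDual ℝ X) :
    ((xs x : ℝ) : EReal) ≤ fitzpatrick A (x, xs) := by
  by_contra! hlt
  have hbound : ∀ a ∈ gra A, a.2 x + xs a.1 - a.2 a.1 < xs x := fun a ha =>
    EReal.coe_lt_coe_iff.mp (lt_of_le_of_lt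
      (le_iSup₂ (f := fun (a : X × StrongDual ℝ X) (_ : a ∈ gra A) =>
        ((a.2 x + xs a.1 - a.2 a.1 : ℝ) : EReal)) a ha) hlt)
  let B : X → Set (StrongDual ℝ X) := fun y => {ys | (y, ys) ∈ insert (x, xs) (gra A)}
  have hB : gra B = insert (x, xs) (gra A) := rfl
  have hmon : IsMonotone B := by
    intro a ha b hb
    rw [hB] at ha hb
    rcases ha with rfl | ha <;> rcases hb with rfl | hb
    · simp
    · have := hbound b hb
      simp only [sub_apply, map_sub]
      linarith
    · have := hbound a ha
      simp only [sub_apply, map_sub]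
      linarith
    · exact hmax.1 a ha b hb
  have hmem : (x, xs) ∈ gra A := by
    rw [← hmax.2 B hmon (hB ▸ Set.subset_insert _ _), hB]
    exact Set.mem_insert _ _
  have := hbound _ hmem
  simp at this

theorem fitzpatrick_sub_add (hsymm : IsSymmetric A) {v : X × StrongDual ℝ X} (hv : v ∈ gra A)
    (x : X) (xs : StrongDual ℝ X) :
    fitzpatrick A (x - v.1, xs + v.2) = fitzpatrick A (x, xs) := by
  refine iSup_congr fun a => iSup_congr fun ha => ?_
  have := hsymm a ha v hv
  congr 1
  simp only [add_apply, map_sub]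
  linarith

theorem fitzpatrick_neg_add_le (hmax : IsMaximalMonotone A) (hsymm : IsSymmetric A) (x : X)
    (xs : StrongDual ℝ X) :
    fitzpatrick A (x, -xs) + ((xs x : ℝ) : EReal) ≤ fitzpatrick A (x, xs) := by
  refine EReal.add_le_of_le_sub (iSup₂_le fun v hv => ?_)
  refine EReal.le_sub_iff_add_le (by simp) (by simp) |>.mpr ?_
  refine le_trans (le_of_eq ?_)
    ((pairing_le_fitzpatrick hmax (x - v.1) (xs + v.2)).trans_eq (fitzpatrick_sub_add hsymm hv x xs))
  rw [← EReal.coe_add]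
  congr 1
  simp only [add_apply, neg_apply, map_sub]
  ring

/-- In other words, `F_A(x, x*) - ½⟨x, x*⟩` is even in `x*`. -/
theorem fitzpatrick_neg (hmax : IsMaximalMonotone A) (hsymm : IsSymmetric A) (x : X)
    (xs : StrongDual ℝ X) :
    fitzpatrick A (x, -xs) = fitzpatrick A (x, xs) - ((xs x : ℝ) : EReal) := by
  apply le_antisymm
  · exact (EReal.le_sub_iff_add_le (by simp) (by simp)).mpr (fitzpatrick_neg_add_le hmax hsymm x xs)
  · have h := fitzpatrick_neg_add_le hmax hsymm x (-xs)
    rw [neg_neg] at h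
    simpa [sub_eq_add_neg] using h

/-! ### Chains in the graph -/

/-- The supremum over chains is reached by equally spaced ones, so only the first and last points
matter; the two terms on the right come from their half sum and their difference. -/
theorem fitzpatrickOrder_eq_add (hlin : IsLinearRelation A) (hmon : IsMonotone A)
    (hsymm : IsSymmetric A) (m : ℕ) (x : X) (xs : StrongDual ℝ X) :
    fitzpatrickOrder A (m + 2) (x, xs)
      = fitzpatrick A (x, xs) + ((m / (m + 2) : ℝ) : EReal) * fitzpatrick A (x, -xs) := by
  have := hlin.nonempty_gra
  have hm2 : (m + 2 : ℝ) ≠ 0 := by positivity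
  rw [fitzpatrick_eq_iSup, fitzpatrick_eq_iSup, iSup_add_mul_iSup _ _ (by positivity)]
  apply le_antisymm
  · refine iSup₂_le fun a ha => ?_
    simp only [Nat.add_sub_cancel, show m + 2 - 1 = m + 1 from rfl] at ha ⊢
    have hs : a 1 ∈ gra A := ha 1 (by simp)
    have ht : a (m + 1) ∈ gra A := ha (m + 1) (by simp)
    -- the common step of the equally spaced chain with the same end points
    obtain ⟨z, hz, hst⟩ : ∃ z ∈ gra A, a (m + 1) = a 1 + (m : ℝ) • z := by
      rcases Nat.eq_zero_or_pos m with rfl | hpos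
      · exact ⟨0, hlin.zero_mem, by simp⟩
      · refine ⟨(1 / (m : ℝ)) • (a (m + 1) - a 1), hlin.smul_mem _ (hlin.sub_mem ht hs), ?_⟩
        have : (m : ℝ) ≠ 0 := by positivity
        rw [smul_smul, mul_one_div_cancel this, one_smul, add_sub_cancel]
    have hchain : ∀ k ≤ m, ∑ i ∈ Finset.Icc 1 k, (a i).2 ((a (i + 1)).1 - (a i).1)
        ≤ (a (k + 1)).2 (a (k + 1)).1 / 2 - (a 1).2 (a 1).1 / 2
          - z.2 ((a (k + 1)).1 - (a 1).1) + k * (z.2 z.1 / 2) := by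
      intro k
      induction k with
      | zero => intro _; simp
      | succ k ih =>
        intro hk
        have h0 := ih (by omega)
        have h1 : a (k + 1) ∈ gra A := ha _ (by simp; omega)
        have h2 : a (k + 1 + 1) ∈ gra A := ha _ (by simp; omega)
        have h3 := hmon _ (hlin.sub_mem h2 h1) _ hz
        have e1 := hsymm _ h1 _ h2
        have e2 := hsymm _ h1 _ hz
        have e3 := hsymm _ h2 _ hz
        rw [Finset.sum_Icc_succ_top (by omega)]
        simp only [Prod.fst_sub, Prod.snd_sub, sub_apply, map_sub] at h3 h0 ⊢
        push_cast
        linarith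
    have hsum := hchain m le_rfl
    let u : gra A := ⟨a 1 + (m / 2 : ℝ) • z, hlin.add_mem hs (hlin.smul_mem _ hz)⟩
    let w : gra A := ⟨((m + 2) / 2 : ℝ) • z, hlin.smul_mem _ hz⟩
    refine le_iSup_of_le ((u, w) : gra A × gra A) (EReal.coe_le_coe_iff.mpr ?_)
    have e := hsymm _ hs _ hz
    simp only [u, w, hst, Prod.fst_add, Prod.snd_add, Prod.smul_fst, Prod.smul_snd,
      add_apply, smul_apply,
      neg_apply, map_add, map_sub, map_smul, smul_eq_mul, e] at hsum ⊢
    field_simp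
    nlinarith
  · refine iSup_le fun ⟨⟨u, hu⟩, ⟨w, hw⟩⟩ => ?_
    -- for `1 ≤ i ≤ m + 1` the coefficient runs from `-m / (m + 2)` to `m / (m + 2)`
    let a : ℕ → X × StrongDual ℝ X := fun i => u + ((2 * i - 2 - m) / (m + 2) : ℝ) • w
    have ha : ∀ i, a i ∈ gra A := fun i => hlin.add_mem hu (hlin.smul_mem _ hw)
    have hchain : ∀ k, ∑ i ∈ Finset.Icc 1 k, (a i).2 ((a (i + 1)).1 - (a i).1)
        = (a (k + 1)).2 (a (k + 1)).1 / 2 - (a 1).2 (a 1).1 / 2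
          - k * (2 / (m + 2) ^ 2 * w.2 w.1) := by
      intro k
      induction k with
      | zero => simp
      | succ k ih =>
        rw [Finset.sum_Icc_succ_top (by omega), ih]
        have e := hsymm _ hu _ hw
        simp only [a, Prod.fst_add, Prod.snd_add, Prod.smul_fst, Prod.smul_snd,
          add_apply, smul_apply,
          map_add, map_sub, map_smul, smul_eq_mul, e]
        push_cast
        field_simp
        ring
    refine le_iSup₂_of_le a (fun i _ => ha i) (EReal.coe_le_coe_iff.mpr (le_of_eq ?_))
    simp only [Nat.add_sub_cancel, show m + 2 - 1 = m + 1 from rfl, hchain]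
    have e := hsymm _ hu _ hw
    simp only [a, Prod.fst_add, Prod.snd_add, Prod.smul_fst, Prod.smul_snd,
      add_apply, smul_apply,
      neg_apply, map_add, map_sub, map_smul, smul_eq_mul, e]
    push_cast
    field_simp
    ring

/-! ### The lower semicontinuous hull of the quadratic form -/

/-- The supremum of the affine functions `x ↦ ⟨x, a*⟩ - ½⟨a, a*⟩` over the graph of `A`. In the
symmetric monotone case these are the affine minorants of `q_A` that are exact at a point of the domain. -/
def affineEnvelope (A : X → Set (StrongDual ℝ X)) (x : X) : EReal :=
  ⨆ a : gra A, ((a.1.2 x - 1 / 2 * a.1.2 a.1.1 : ℝ) : EReal)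

theorem affineEnvelope_nonneg (hlin : IsLinearRelation A) (x : X) : 0 ≤ affineEnvelope A x := by
  refine le_trans (le_of_eq ?_) (le_iSup _ (⟨0, hlin.zero_mem⟩ : gra A))
  simp

theorem conjugate_quad (hlin : IsLinearRelation A) (hmon : IsMonotone A) (xs : StrongDual ℝ X) :
    conjugate (quad A) xs = ⨆ a : gra A, ((xs a.1.1 - 1 / 2 * a.1.2 a.1.1 : ℝ) : EReal) := by
  apply le_antisymm
  · refine iSup_le fun y => ?_
    by_cases hy : (A y).Nonempty
    · obtain ⟨ys, hys⟩ := hy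
      rw [quad_eq hlin hmon hys, ← EReal.coe_sub]
      exact le_iSup (fun a : gra A => ((xs a.1.1 - 1 / 2 * a.1.2 a.1.1 : ℝ) : EReal))
        ⟨(y, ys), hys⟩
    · simp [quad_eq_top hy]
  · refine iSup_le fun a => ?_
    refine le_trans (le_of_eq ?_) (le_iSup _ a.1.1)
    rw [quad_eq hlin hmon a.2, ← EReal.coe_sub]

theorem conjugate_quad_nonneg (hlin : IsLinearRelation A) (hmon : IsMonotone A)
    (xs : StrongDual ℝ X) : 0 ≤ conjugate (quad A) xs := by
  rw [conjugate_quad hlin hmon]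
  refine le_trans (le_of_eq ?_) (le_iSup _ (⟨0, hlin.zero_mem⟩ : gra A))
  simp

theorem affineEnvelope_add_conjugate (hlin : IsLinearRelation A) (hmon : IsMonotone A)
    (hsymm : IsSymmetric A) (x : X) (xs : StrongDual ℝ X) :
    affineEnvelope A x + conjugate (quad A) xs
      = fitzpatrick A (x, xs) + fitzpatrick A (x, -xs) := by
  have := hlin.nonempty_gra
  have h1 := iSup_add_mul_iSup (fun a : gra A => a.1.2 x - 1 / 2 * a.1.2 a.1.1)
    (fun a : gra A => xs a.1.1 - 1 / 2 * a.1.2 a.1.1) zero_le_one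
  have h2 := iSup_add_mul_iSup (fun a : gra A => a.1.2 x + xs a.1.1 - a.1.2 a.1.1)
    (fun a : gra A => a.1.2 x + (-xs) a.1.1 - a.1.2 a.1.1) zero_le_one
  rw [EReal.coe_one, one_mul] at h1 h2
  rw [conjugate_quad hlin hmon, affineEnvelope, h1, fitzpatrick_eq_iSup, fitzpatrick_eq_iSup, h2]
  apply le_antisymm
  · refine iSup_le fun ⟨⟨t, ht⟩, ⟨s, hs⟩⟩ => ?_
    let u : gra A := ⟨(1 / 2 : ℝ) • (t + s), hlin.smul_mem _ (hlin.add_mem ht hs)⟩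
    let v : gra A := ⟨(1 / 2 : ℝ) • (t - s), hlin.smul_mem _ (hlin.sub_mem ht hs)⟩
    refine le_iSup_of_le ((u, v) : gra A × gra A) (EReal.coe_le_coe_iff.mpr (le_of_eq ?_))
    have e := hsymm _ hs _ ht
    simp only [u, v, Prod.fst_add, Prod.snd_add, Prod.fst_sub, Prod.snd_sub, Prod.smul_fst,
      Prod.smul_snd, add_apply, smul_apply,
      sub_apply, neg_apply, map_add, map_sub, map_smul,
      smul_eq_mul, e]
    ring
  · refine iSup_le fun ⟨⟨u, hu⟩, ⟨v, hv⟩⟩ => ?_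
    let t : gra A := ⟨u + v, hlin.add_mem hu hv⟩
    let s : gra A := ⟨u - v, hlin.sub_mem hu hv⟩
    refine le_iSup_of_le ((t, s) : gra A × gra A) (EReal.coe_le_coe_iff.mpr (le_of_eq ?_))
    have e := hsymm _ hu _ hv
    simp only [t, s, Prod.fst_add, Prod.snd_add, Prod.fst_sub, Prod.snd_sub,
      add_apply, sub_apply,
      neg_apply, map_add, map_sub, e]
    ring

theorem affineEnvelope_le_lscHull (hlin : IsLinearRelation A) (hmon : IsMonotone A)
    (hsymm : IsSymmetric A) (x : X) : affineEnvelope A x ≤ lscHull (quad A) x := by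
  refine iSup_le fun ⟨a, ha⟩ => ?_
  refine le_iSup₂ (f := fun (g : X → EReal)
    (_ : LowerSemicontinuous g ∧ ∀ y, g y ≤ quad A y) => g x)
    (fun y => ((a.2 y - 1 / 2 * a.2 a.1 : ℝ) : EReal)) ⟨?_, fun y => ?_⟩
  · exact (continuous_coe_real_ereal.comp
      (a.2.continuous.sub continuous_const)).lowerSemicontinuous
  · by_cases hy : (A y).Nonempty
    · obtain ⟨ys, hys⟩ := hy
      have h := hmon (y, ys) hys a ha
      have e : ys a.1 = a.2 y := hsymm (y, ys) hys a ha
      rw [quad_eq hlin hmon hys, EReal.coe_le_coe_iff]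
      simp only [sub_apply, map_sub] at h
      linarith
    · simp [quad_eq_top hy]

/-- The lower semicontinuous hull is at most the biconjugate: a level below the hull at `x` is
attained at `x` by a continuous affine minorant of `q_A`. -/
theorem exists_conjugate_le_of_lt_lscHull (hlin : IsLinearRelation A) (hmon : IsMonotone A)
    (hsymm : IsSymmetric A) {x : X} {r : ℝ} (hr : (r : EReal) < lscHull (quad A) x) :
    ∃ xs : StrongDual ℝ X, conjugate (quad A) xs ≤ ((xs x - r : ℝ) : EReal) := by
  simp only [lscHull, lt_iSup_iff] at hr
  obtain ⟨g, ⟨hg, hgq⟩, hgx⟩ := hr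
  obtain ⟨δ, hδ, hball⟩ := Metric.eventually_nhds_iff_ball.mp (hg x r hgx)
  let E : Set (X × ℝ) := {p | ∃ ys, (p.1, ys) ∈ gra A ∧ 1 / 2 * ys p.1 ≤ p.2}
  have hE : Convex ℝ E := by
    rintro ⟨y₁, t₁⟩ ⟨a, ha, ha'⟩ ⟨y₂, t₂⟩ ⟨b, hb, hb'⟩ c d hc hd hcd
    refine ⟨c • a + d • b, hlin.add_mem (hlin.smul_mem c ha) (hlin.smul_mem d hb), ?_⟩
    have h := hmon _ ha _ hb
    have e : a y₂ = b y₁ := hsymm _ ha _ hb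
    simp only [sub_apply, map_sub, Prod.fst_add, Prod.snd_add, Prod.smul_fst,
      Prod.smul_snd, add_apply, smul_apply,
      map_add, map_smul, smul_eq_mul, e] at h ha' hb' ⊢
    obtain rfl : d = 1 - c := by linarith
    have h1 := mul_le_mul_of_nonneg_left ha' hc
    have h2 := mul_le_mul_of_nonneg_left hb' hd
    have h3 := mul_nonneg (mul_nonneg hc hd) h
    nlinarith
  have hdisj : Disjoint (Metric.ball x δ ×ˢ Set.Iio r) E := by
    rw [Set.disjoint_left]
    rintro ⟨y, t⟩ ⟨hy, ht⟩ ⟨ys, hys, hle⟩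
    have h := (hball y hy).trans_le (hgq y)
    rw [quad_eq hlin hmon hys, EReal.coe_lt_coe_iff] at h
    simp only [Set.mem_Iio] at ht hle
    linarith
  obtain ⟨f, c, hU, hV⟩ := geometric_hahn_banach_open
    ((convex_ball x δ).prod (convex_Iio r)) (Metric.isOpen_ball.prod isOpen_Iio) hE hdisj
  let l : StrongDual ℝ X := f.comp (ContinuousLinearMap.inl ℝ X ℝ)
  let β : ℝ := f (0, 1)
  have hf : ∀ y t, f (y, t) = l y + t * β := by
    intro y t
    have : ((y, t) : X × ℝ) = (y, 0) + t • (0, 1) := by simp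
    rw [this, map_add, map_smul]
    rfl
  have hx : ∀ t < r, l x + t * β < c := fun t ht => by
    rw [← hf]; exact hU _ ⟨Metric.mem_ball_self hδ, ht⟩
  have hgra : ∀ a ∈ gra A, ∀ s : ℝ, 0 ≤ s → c ≤ l a.1 + (1 / 2 * a.2 a.1 + s) * β := by
    intro a ha s hs
    rw [← hf]
    exact hV _ ⟨a.2, ha, by simpa using hs⟩
  have hβ : 0 ≤ β := by
    by_contra! hneg
    have h := hgra 0 hlin.zero_mem (|c| / (-β) + 1) (by have := neg_pos.mpr hneg; positivity)
    have h' : |c| / (-β) * β = -|c| := by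
      rw [div_neg, neg_mul, div_mul_cancel₀ _ hneg.ne]
    simp only [Prod.fst_zero, map_zero, Prod.snd_zero, mul_zero, zero_add, add_mul, h'] at h
    have := neg_abs_le c
    linarith
  have hquad : ∀ a ∈ gra A, 0 ≤ a.2 a.1 := fun a ha => by
    simpa using hmon a ha 0 hlin.zero_mem
  rcases hβ.eq_or_lt with h0 | hpos
  -- If the hyperplane is vertical, `l` vanishes on the domain but not at `x`, and a multiple of it
  -- serves as `xs`.
  · simp only [← h0, mul_zero, add_zero] at hx hgra
    have hlx : l x < c := hx (r - 1) (by linarith)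
    have hc : c ≤ 0 := by simpa using hgra 0 hlin.zero_mem 0 le_rfl
    have hl : ∀ a ∈ gra A, l a.1 = 0 := by
      intro a ha
      by_contra hne
      have h := hgra _ (hlin.smul_mem ((c - 1) / l a.1) ha) 0 le_rfl
      rw [Prod.smul_fst, map_smul, smul_eq_mul, div_mul_cancel₀ _ hne] at h
      linarith
    refine ⟨(r / l x) • l, ?_⟩
    rw [conjugate_quad hlin hmon]
    refine iSup_le fun ⟨a, ha⟩ => EReal.coe_le_coe_iff.mpr ?_
    have := hquad a ha
    simp only [smul_apply, smul_eq_mul, hl a ha,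
      div_mul_cancel₀ _ (show l x ≠ 0 by linarith)]
    linarith
  · have hle : l x + r * β ≤ c := by
      by_contra! hlt
      have h := hx (r - (l x + r * β - c) / β) (by
        have : 0 < (l x + r * β - c) / β := div_pos (by linarith) hpos
        linarith)
      rw [sub_mul, div_mul_cancel₀ _ hpos.ne'] at h
      linarith
    refine ⟨(-(1 / β)) • l, ?_⟩
    rw [conjugate_quad hlin hmon]
    refine iSup_le fun ⟨a, ha⟩ => EReal.coe_le_coe_iff.mpr ?_
    have h := hgra a ha 0 le_rfl
    simp only [smul_apply, smul_eq_mul]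
    rw [← sub_nonneg]
    have : -(1 / β) * l x - r - (-(1 / β) * l a.1 - 1 / 2 * a.2 a.1)
        = (l a.1 + (1 / 2 * a.2 a.1 + 0) * β - (l x + r * β)) / β := by
      field_simp
      ring
    rw [this]
    exact div_nonneg (by linarith) hpos.le

theorem lscHull_quad (hlin : IsLinearRelation A) (hmax : IsMaximalMonotone A)
    (hsymm : IsSymmetric A) (x : X) : lscHull (quad A) x = affineEnvelope A x := by
  refine le_antisymm ?_ (affineEnvelope_le_lscHull hlin hmax.1 hsymm x)
  by_contra! hlt
  obtain ⟨r, hpr, hr⟩ := EReal.lt_iff_exists_real_btwn.mp hlt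
  obtain ⟨xs, hxs⟩ := exists_conjugate_le_of_lt_lscHull hlin hmax.1 hsymm hr
  have h1 := affineEnvelope_add_conjugate hlin hmax.1 hsymm x xs
  have h2 := add_le_add (pairing_le_fitzpatrick hmax x xs) (fitzpatrick_nonneg hlin (x, -xs))
  rw [← h1, add_zero] at h2
  have h3 := h2.trans (add_le_add_right hxs (affineEnvelope A x))
  induction hp : affineEnvelope A x with
  | top => simp [hp] at hpr
  | bot => simpa [hp] using affineEnvelope_nonneg hlin x
  | coe p =>
    rw [hp, EReal.coe_lt_coe_iff] at hpr
    rw [hp, ← EReal.coe_add, EReal.coe_le_coe_iff] at h3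
    linarith

/-! ### The closed formulas -/

theorem lscHull_add_conjugate (hlin : IsLinearRelation A) (hmax : IsMaximalMonotone A)
    (hsymm : IsSymmetric A) (x : X) (xs : StrongDual ℝ X) :
    lscHull (quad A) x + conjugate (quad A) xs
      = ((2 : ℝ) : EReal) * fitzpatrick A (x, xs) - ((xs x : ℝ) : EReal) := by
  rw [lscHull_quad hlin hmax hsymm, affineEnvelope_add_conjugate hlin hmax.1 hsymm,
    fitzpatrick_neg hmax hsymm]
  have h0 := fitzpatrick_nonneg hlin (x, xs)
  generalize fitzpatrick A (x, xs) = F at h0 ⊢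
  induction F with
  | top => simp [EReal.coe_mul_top_of_pos]
  | bot => simp at h0
  | coe F =>
    norm_cast
    ring_nf

theorem fitzpatrickOrder_eq_fitzpatrick (hlin : IsLinearRelation A) (hmax : IsMaximalMonotone A)
    (hsymm : IsSymmetric A) {n : ℕ} (hn : 2 ≤ n) (x : X) (xs : StrongDual ℝ X) :
    fitzpatrickOrder A n (x, xs)
      = ((2 * ((n : ℝ) - 1) / n : ℝ) : EReal) * fitzpatrick A (x, xs)
        + (((2 - (n : ℝ)) / n * xs x : ℝ) : EReal) := by
  obtain ⟨m, rfl⟩ := Nat.exists_eq_add_of_le' hn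
  rw [fitzpatrickOrder_eq_add hlin hmax.1 hsymm, fitzpatrick_neg hmax hsymm]
  have h0 := fitzpatrick_nonneg hlin (x, xs)
  have hpos : 0 < 2 * (((m + 2 : ℕ) : ℝ) - 1) / ((m + 2 : ℕ) : ℝ) := by
    push_cast
    have : (0 : ℝ) < m + 2 - 1 := by
      have : (0 : ℝ) ≤ m := m.cast_nonneg
      linarith
    positivity
  generalize fitzpatrick A (x, xs) = F at h0 ⊢
  induction F with
  | top =>
    rw [EReal.coe_mul_top_of_pos hpos, EReal.top_add_coe, EReal.top_sub_coe]
    refine EReal.top_add_of_ne_bot (ne_of_gt (lt_of_lt_of_le EReal.bot_lt_zero ?_))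
    exact mul_nonneg (EReal.coe_nonneg.mpr (by positivity)) le_top
  | bot => simp at h0
  | coe F =>
    rw [← EReal.coe_sub, ← EReal.coe_mul, ← EReal.coe_mul, ← EReal.coe_add, ← EReal.coe_add]
    congr 1
    push_cast
    field_simp
    ring

theorem fitzpatrickOrder_eq_lscHull_add_conjugate (hlin : IsLinearRelation A)
    (hmax : IsMaximalMonotone A) (hsymm : IsSymmetric A) {n : ℕ} (hn : 2 ≤ n) (x : X)
    (xs : StrongDual ℝ X) :
    fitzpatrickOrder A n (x, xs)
      = ((((n : ℝ) - 1) / n : ℝ) : EReal) * lscHull (quad A) x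
        + ((((n : ℝ) - 1) / n : ℝ) : EReal) * conjugate (quad A) xs
        + ((1 / (n : ℝ) * xs x : ℝ) : EReal) := by
  have hn' : (2 : ℝ) ≤ n := by exact_mod_cast hn
  have hpos : 0 < ((n : ℝ) - 1) / n := div_pos (by linarith) (by linarith)
  have hq : 0 ≤ lscHull (quad A) x := by
    rw [lscHull_quad hlin hmax hsymm]; exact affineEnvelope_nonneg hlin x
  rw [← EReal.left_distrib_of_nonneg hq (conjugate_quad_nonneg hlin hmax.1 xs),
    lscHull_add_conjugate hlin hmax hsymm, fitzpatrickOrder_eq_fitzpatrick hlin hmax hsymm hn]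
  have h0 := fitzpatrick_nonneg hlin (x, xs)
  generalize fitzpatrick A (x, xs) = F at h0 ⊢
  induction F with
  | top =>
    rw [EReal.coe_mul_top_of_pos two_pos, EReal.top_sub_coe, EReal.coe_mul_top_of_pos hpos,
      EReal.coe_mul_top_of_pos (by rw [mul_div_assoc]; positivity), EReal.top_add_coe,
      EReal.top_add_coe]
  | bot => simp at h0
  | coe F =>
    rw [← EReal.coe_mul, ← EReal.coe_mul, ← EReal.coe_sub, ← EReal.coe_mul, ← EReal.coe_add,
      ← EReal.coe_add]
    congr 1
    field_simp
    ring

theorem fitzpatrickInfty_eq_add (hlin : IsLinearRelation A) (hmax : IsMaximalMonotone A)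
    (hsymm : IsSymmetric A) (x : X) (xs : StrongDual ℝ X) :
    fitzpatrickInfty A (x, xs) = fitzpatrick A (x, xs) + fitzpatrick A (x, -xs) := by
  have hF := fitzpatrick_nonneg hlin (x, xs)
  have hF' := fitzpatrick_nonneg hlin (x, -xs)
  have hle : ∀ m : ℕ, fitzpatrick A (x, xs) + ((m / (m + 2) : ℝ) : EReal) * fitzpatrick A (x, -xs)
      ≤ fitzpatrickInfty A (x, xs) := fun m => by
    rw [← fitzpatrickOrder_eq_add hlin hmax.1 hsymm]
    exact le_iSup₂ (f := fun (n : ℕ) (_ : 2 ≤ n) => fitzpatrickOrder A n (x, xs)) (m + 2) (by omega)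
  apply le_antisymm
  · refine iSup₂_le fun n hn => ?_
    obtain ⟨m, rfl⟩ := Nat.exists_eq_add_of_le' hn
    rw [fitzpatrickOrder_eq_add hlin hmax.1 hsymm]
    refine add_le_add_right ?_ _
    refine (mul_le_mul_of_nonneg_right (c := 1) ?_ hF').trans_eq (one_mul _)
    exact_mod_cast (div_le_one (by positivity : (0 : ℝ) < m + 2)).mpr (by linarith)
  · rw [fitzpatrick_neg hmax hsymm] at hle hF' ⊢
    generalize fitzpatrick A (x, xs) = F at hle hF ⊢
    induction F with
    | top => simpa using hle 0
    | bot => simp at hF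
    | coe F =>
      have hlim : Filter.Tendsto (fun m : ℕ => F + (m : ℝ) / (m + 2) * (F - xs x)) Filter.atTop
          (nhds (F + 1 * (F - xs x))) :=
        ((tendsto_natCast_div_add_atTop (2 : ℝ)).mul_const _).const_add _
      have h := le_of_tendsto' ((continuous_coe_real_ereal.tendsto _).comp hlim) (fun m => by
        simpa using hle m)
      simpa using h

end FitzpatrickLinRel

end

theorem theorem3p9 {X : Type*} [NormedAddCommGroup X] [NormedSpace ℝ X] [CompleteSpace X]
    (hrefl : Function.Surjective (NormedSpace.inclusionInDoubleDual ℝ X))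
    (A : X → Set (StrongDual ℝ X))
    (hlin : FitzpatrickLinRel.IsLinearRelation A)
    (hmax : FitzpatrickLinRel.IsMaximalMonotone A)
    (hsymm : FitzpatrickLinRel.IsSymmetric A) :
    (∀ n : ℕ, 2 ≤ n → ∀ (x : X) (xs : StrongDual ℝ X),
      FitzpatrickLinRel.fitzpatrickOrder A n (x, xs)
          = ((((n : ℝ) - 1) / n : ℝ) : EReal)
              * FitzpatrickLinRel.lscHull (FitzpatrickLinRel.quad A) x
            + ((((n : ℝ) - 1) / n : ℝ) : EReal)
              * FitzpatrickLinRel.conjugate (FitzpatrickLinRel.quad A) xs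
            + ((1 / (n : ℝ) * xs x : ℝ) : EReal)
      ∧ FitzpatrickLinRel.fitzpatrickOrder A n (x, xs)
          = ((2 * ((n : ℝ) - 1) / n : ℝ) : EReal) * FitzpatrickLinRel.fitzpatrick A (x, xs)
            + (((2 - (n : ℝ)) / n * xs x : ℝ) : EReal))
    ∧ FitzpatrickLinRel.fitzpatrickInfty A
        = FitzpatrickLinRel.directSum (FitzpatrickLinRel.lscHull (FitzpatrickLinRel.quad A))
            (FitzpatrickLinRel.conjugate (FitzpatrickLinRel.quad A))
    ∧ FitzpatrickLinRel.directSum (FitzpatrickLinRel.lscHull (FitzpatrickLinRel.quad A))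
          (FitzpatrickLinRel.conjugate (FitzpatrickLinRel.quad A))
        = fun p : X × StrongDual ℝ X =>
            ((2 : ℝ) : EReal) * FitzpatrickLinRel.fitzpatrick A p - ((p.2 p.1 : ℝ) : EReal) := by
  open FitzpatrickLinRel in
  refine ⟨fun n hn x xs =>
    ⟨fitzpatrickOrder_eq_lscHull_add_conjugate hlin hmax hsymm hn x xs,
      fitzpatrickOrder_eq_fitzpatrick hlin hmax hsymm hn x xs⟩,
    funext fun ⟨x, xs⟩ => ?_, funext fun ⟨x, xs⟩ => lscHull_add_conjugate hlin hmax hsymm x xs⟩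
  rw [FitzpatrickLinRel.fitzpatrickInfty_eq_add hlin hmax hsymm, FitzpatrickLinRel.directSum,
    FitzpatrickLinRel.lscHull_quad hlin hmax hsymm,
    FitzpatrickLinRel.affineEnvelope_add_conjugate hlin hmax.1 hsymm]
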